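/- Let $n,m,k$ be nonnegative integers and let $\widehat{\mathbb S}^n$ be the space of real symmetric matrices with rows and columns indexed by $\{0\}\cup[n]$, with the trace inner product $\langle X,Y\rangle=\operatorname{tr}(XY^{\mathsf T})$. Let $\mathcal A\colon\widehat{\mathbb S}^n\to\mathbb R^m$ and $\mathcal L\colon\mathbb R^k\to\widehat{\mathbb S}^n$ be linear maps with adjoints $\mathcal A^*,\mathcal L^*$, and let $b\in\mathbb R^m$. The system $\mathcal A(\widehat X)\le b$, $\widehat X\succeq0$ is called totally dual integral (TDI) through $\mathcal L$ if, for every $c\in\mathbb Z^k$, the following holds: whenever the dual SDP $$\inf\{\,b^{\mathsf T}y : y\in\mathbb R^m_+,\ \widehat S=\mathcal A^*(y)-\mathcal L(c)\succeq 0\,\}$$ of $\sup\{\langle\mathcal L(c),\widehat X\rangle:\mathcal A(\widehat X)\le b,\ \widehat X\succeq0\}$ has an optimal solution, it has an optimal solution $(y,\widehat S)$ that is integral, i.e., $y\in\mathbb Z^m_+$ and $$\widehat S=\sum_{U\subseteq[n]}\mu_U\begin{bmatrix}-1\\ \mathbb 1_U\end{bmatrix}\begin{bmatrix}-1\\ \mathbb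 1_U\end{bmatrix}^{\mathsf T}\quad\text{for some nonnegative integers }\mu_U\ (U\subseteq[n]),$$ where $\mathbb 1_U\in\{0,1\}^n$ is the incidence vector of $U$. Theorem. Suppose that the system $\mathcal A(\widehat X)\le b$, $\widehat X\succeq 0$ is TDI through $\mathcal L$. Put $\widehat{\mathscr C}=\{\widehat X\in\widehat{\mathbb S}^n:\widehat X\succeq0,\ \mathcal A(\widehat X)\le b\}$ and $\mathscr C=\mathcal L^*(\widehat{\mathscr C})\subseteq\mathbb R^k$. If $b$ is integral, $\mathscr C$ is compact, and $\widehat{\mathscr C}$ contains a positive definite matrix, then $\mathscr C=\mathscr C_I$, where $\mathscr C_I=\operatorname{conv}(\mathscr C\cap\mathbb Z^k)$ is the integer hull of $\mathscr C$. -/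

import Mathlib

open scoped Matrix Matrix.Norms.Frobenius

/-- The trace inner product `⟨X, Y⟩ = tr (X Yᵀ)` on real square matrices; the norm that it induces
is the Frobenius norm. -/
noncomputable instance Matrix.traceInnerProductSpace (d : ℕ) :
    InnerProductSpace ℝ (Matrix (Fin d) (Fin d) ℝ) where
  inner X Y := (X * Yᵀ).trace
  norm_sq_eq_re_inner X := by
    rw [Matrix.frobenius_norm_def, ← Real.sqrt_eq_rpow, Real.sq_sqrt (by positivity)]
    simp [Matrix.trace, Matrix.mul_apply, ← pow_two]
  conj_inner_symm X Y := by
    rw [← Matrix.trace_transpose (Y * Xᵀ)]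
    simp
  add_left X Y Z := by simp [add_mul]
  smul_left X Y r := by simp

namespace SemidefTDI

/-- The space of real symmetric matrices indexed by `{0} ∪ [n]`. The index `0 : Fin (n + 1)` is the
extra index, and `i.succ` stands for the element `i` of the ground set. It carries the trace inner
product, as a subspace of the space of all matrices. -/
def symHat (n : ℕ) : Submodule ℝ (Matrix (Fin (n + 1)) (Fin (n + 1)) ℝ) where
  carrier := {X | X.IsSymm}
  add_mem' hX hY := hX.add hY
  zero_mem' := Matrix.isSymm_zero
  smul_mem' r _ hX := hX.smul r

variable {n m k : ℕ}

/-- A real vector with integer entries. -/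
def IsIntegralVec {d : ℕ} (x : EuclideanSpace ℝ (Fin d)) : Prop :=
  ∀ i, ∃ z : ℤ, x i = z

/-- The integer hull: the convex hull of the integer points of a set. -/
def integerHull {d : ℕ} (C : Set (EuclideanSpace ℝ (Fin d))) : Set (EuclideanSpace ℝ (Fin d)) :=
  convexHull ℝ {x | x ∈ C ∧ IsIntegralVec x}

/-- The feasible set of the system `𝒜(X) ≤ b`, `X ⪰ 0`. -/
def feasibleSet (𝒜 : symHat n →ₗ[ℝ] EuclideanSpace ℝ (Fin m)) (b : EuclideanSpace ℝ (Fin m)) :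
    Set (symHat n) :=
  {X | (X : Matrix (Fin (n + 1)) (Fin (n + 1)) ℝ).PosSemidef ∧ ∀ i, 𝒜 X i ≤ b i}

/-- The dual slack matrix `𝒜*(y) - C`. -/
noncomputable def dualSlack (𝒜 : symHat n →ₗ[ℝ] EuclideanSpace ℝ (Fin m)) (C : symHat n)
    (y : EuclideanSpace ℝ (Fin m)) : symHat n :=
  LinearMap.adjoint 𝒜 y - C

/-- Feasibility in the dual SDP
`inf {⟨b, y⟩ : y ≥ 0, 𝒜*(y) - C ⪰ 0}` of `sup {⟨C, X⟩ : 𝒜(X) ≤ b, X ⪰ 0}`. -/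
def IsDualFeasible (𝒜 : symHat n →ₗ[ℝ] EuclideanSpace ℝ (Fin m)) (C : symHat n)
    (y : EuclideanSpace ℝ (Fin m)) : Prop :=
  (∀ i, 0 ≤ y i) ∧
    (dualSlack 𝒜 C y : Matrix (Fin (n + 1)) (Fin (n + 1)) ℝ).PosSemidef

/-- Optimality in the dual SDP. -/
def IsDualOptimal (𝒜 : symHat n →ₗ[ℝ] EuclideanSpace ℝ (Fin m)) (b : EuclideanSpace ℝ (Fin m))
    (C : symHat n) (y : EuclideanSpace ℝ (Fin m)) : Prop :=
  IsDualFeasible 𝒜 C y ∧ ∀ z, IsDualFeasible 𝒜 C z → inner ℝ b y ≤ inner ℝ b z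

/-- The vector `(-1, 𝟙_A)`, where `𝟙_A` is the incidence vector of `A ⊆ [n]`. -/
def signedIncidence (A : Finset (Fin n)) : Fin (n + 1) → ℝ :=
  Fin.cons (-1) fun i => if i ∈ A then 1 else 0

/-- Integrality of a dual slack: `S = ∑_A μ_A (-1, 𝟙_A)(-1, 𝟙_A)ᵀ`, the sum being over the
subsets `A` of `[n]`, for some nonnegative integers `μ_A`. -/
def IsIntegralSlack (S : symHat n) : Prop :=
  ∃ μ : Finset (Fin n) → ℕ,
    (S : Matrix (Fin (n + 1)) (Fin (n + 1)) ℝ) =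
      ∑ A, (μ A : ℝ) • Matrix.vecMulVec (signedIncidence A) (signedIncidence A)

/-- The system `𝒜(X) ≤ b`, `X ⪰ 0` is totally dual integral through `ℒ`: for each integer vector
`c`, the dual of `sup {⟨ℒ(c), X⟩ : 𝒜(X) ≤ b, X ⪰ 0}` has an integral optimal solution (an integer
vector `y` with integral slack) whenever it has an optimal solution. -/
def IsTDIThrough (𝒜 : symHat n →ₗ[ℝ] EuclideanSpace ℝ (Fin m)) (b : EuclideanSpace ℝ (Fin m))
    (ℒ : EuclideanSpace ℝ (Fin k) →ₗ[ℝ] symHat n) : Prop :=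
  ∀ c : EuclideanSpace ℝ (Fin k), IsIntegralVec c →
    (∃ y, IsDualOptimal 𝒜 b (ℒ c) y) →
    ∃ y, IsDualOptimal 𝒜 b (ℒ c) y ∧ IsIntegralVec y ∧ IsIntegralSlack (dualSlack 𝒜 (ℒ c) y)

end SemidefTDI

/-!
On any compact set `C ⊆ ℝᵏ` whose linear maxima in integer directions are integers, each integer
direction `c` has an integral maximizer. Indeed `max_C (N c + e) - N max_C c` is an integer for each
`N`, and it tends to the maximum of `e` over the face of `C` exposed by `c`; so this face inherits
the integrality property, and maximizing the coordinates one after the other leads to an integer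
point. As integer directions are dense among all directions, no point of `C` can be separated from
the integer hull of `C`.

For the image of a semidefinite feasible set, the maxima are the optimal values of dual programs,
by strong duality. Dual attainment follows from M. Riesz's extension theorem, which splits a
functional that is nonnegative on the intersection of the semidefinite cone and a polyhedral cone,
and from Farkas' lemma, which describes the polyhedral part; both are applied to the homogenization
of the program.
-/

namespace SemidefTDI

open Filter Topology Module

section Farkas

variable {𝕜 V ι : Type*} [Field 𝕜] [LinearOrder 𝕜] [IsStrictOrderedRing 𝕜] [AddCommGroup V]
  [Module 𝕜 V]

theorem mem_hull_insert_of_add_smul_mem_hull {S : Set (Dual 𝕜 V)} {a g : Dual 𝕜 V} {w : V}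
    (hS : ∀ f ∈ S, 0 ≤ f w) (hg : g w ≤ 0)
    (h : g + g w • a ∈ PointedCone.hull 𝕜 ((fun f => f + f w • a) '' S)) :
    g ∈ PointedCone.hull 𝕜 (insert a S) := by
  let T : Dual 𝕜 V →ₗ[𝕜] Dual 𝕜 V := LinearMap.id + (Dual.eval 𝕜 V w).smulRight a
  have hmap : (PointedCone.hull 𝕜 S).map T = PointedCone.hull 𝕜 (T '' S) := Submodule.map_span _ S
  obtain ⟨f, hf, hfg⟩ : ∃ f ∈ PointedCone.hull 𝕜 S, T f = T g := by
    rw [← PointedCone.mem_map, hmap]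
    exact h
  have hfw : 0 ≤ f w := by
    have hle : PointedCone.hull 𝕜 S ≤ (PointedCone.positive 𝕜 𝕜).comap (Dual.eval 𝕜 V w) :=
      Submodule.span_le.2 hS
    exact hle hf
  have hdecomp : g = (f w - g w) • a + f := by
    ext x
    have hx : f x + f w * a x = g x + g w * a x := LinearMap.congr_fun hfg x
    simp only [LinearMap.add_apply, LinearMap.smul_apply, smul_eq_mul]
    linear_combination -hx
  rw [hdecomp]
  exact add_mem
    (PointedCone.smul_mem _ (sub_nonneg.2 (hg.trans hfw)) (Submodule.subset_span (by simp)))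
    (Submodule.span_mono (Set.subset_insert _ _) hf)

theorem mem_hull_image_of_forall_nonneg (s : Finset ι) (a : ι → Dual 𝕜 V) (g : Dual 𝕜 V)
    (h : ∀ x, (∀ i ∈ s, 0 ≤ a i x) → 0 ≤ g x) : g ∈ PointedCone.hull 𝕜 (a '' s) := by
  classical
  induction s using Finset.induction_on generalizing a g with
  | empty =>
    have hg : g = 0 := LinearMap.ext fun x =>
      le_antisymm (by simpa using h (-x) (by simp)) (h x (by simp))
    simp [hg]
  | insert j s _ ih =>
    rw [Finset.coe_insert, Set.image_insert_eq]
    by_cases hs : ∀ x, (∀ i ∈ s, 0 ≤ a i x) → 0 ≤ g x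
    · exact Submodule.span_mono (Set.subset_insert _ _) (ih a g hs)
    push Not at hs
    obtain ⟨u, hu, hgu⟩ := hs
    have hju : a j u < 0 := by
      by_contra! hju
      exact hgu.not_ge (h u (Finset.forall_mem_insert _ _ _ |>.2 ⟨hju, hu⟩))
    obtain ⟨w, hw, hgw, hjw⟩ : ∃ w, (∀ i ∈ s, 0 ≤ a i w) ∧ g w ≤ 0 ∧ a j w = -1 := by
      have hr : 0 < (-(a j u))⁻¹ := inv_pos.2 (neg_pos.2 hju)
      refine ⟨(-(a j u))⁻¹ • u, fun i hi => ?_, ?_, ?_⟩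
      · simpa only [map_smul] using smul_nonneg hr.le (hu i hi)
      · simpa only [map_smul] using smul_nonpos_of_nonneg_of_nonpos hr.le hgu.le
      · rw [map_smul, smul_eq_mul, inv_neg, neg_mul, inv_mul_cancel₀ hju.ne]
    refine mem_hull_insert_of_add_smul_mem_hull (w := w) (by simpa using hw) hgw ?_
    rw [Set.image_image]
    -- Composition with the projection `x ↦ x + a j x • w` onto `ker (a j)` maps `f` to
    -- `f + f w • a j`, and points of `ker (a j)` satisfy the constraint `j`.
    refine ih (fun i => a i + a i w • a j) (g + g w • a j) fun x hx => ?_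
    have hnonneg := h (x + a j x • w) (Finset.forall_mem_insert _ _ _ |>.2
      ⟨by simp [hjw], fun i hi => by simpa [mul_comm] using hx i hi⟩)
    simpa [mul_comm] using hnonneg

theorem exists_nonneg_sum_smul_eq_of_forall_nonneg [Fintype ι] (a : ι → Dual 𝕜 V) (g : Dual 𝕜 V)
    (h : ∀ x, (∀ i, 0 ≤ a i x) → 0 ≤ g x) :
    ∃ y : ι → 𝕜, (∀ i, 0 ≤ y i) ∧ ∑ i, y i • a i = g := by
  have hmem := mem_hull_image_of_forall_nonneg Finset.univ a g (by simpa using h)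
  rw [Finset.coe_univ, Set.image_univ] at hmem
  obtain ⟨y, hy⟩ := (Submodule.mem_span_range_iff_exists_fun _).1 hmem
  exact ⟨fun i => y i, fun i => (y i).2, hy⟩

end Farkas

section ConicDuality

variable {V ι : Type*} [AddCommGroup V] [Module ℝ V]

theorem exists_nonneg_on_add_nonneg_on_eq {P Q : PointedCone ℝ V} {x₀ : V} (hx₀ : x₀ ∈ Q)
    (hunit : ∀ y, ∀ᶠ r : ℝ in atTop, y + r • x₀ ∈ P) (g : Dual ℝ V)
    (hg : ∀ x ∈ P, x ∈ Q → 0 ≤ g x) :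
    ∃ s q : Dual ℝ V, (∀ x ∈ P, 0 ≤ s x) ∧ (∀ x ∈ Q, 0 ≤ q x) ∧ s + q = g := by
  let diag : V →ₗ[ℝ] V × V := LinearMap.id.prod LinearMap.id
  let f : V × V →ₗ.[ℝ] ℝ :=
    ⟨LinearMap.range diag, g ∘ₗ LinearMap.fst ℝ V V ∘ₗ (LinearMap.range diag).subtype⟩
  obtain ⟨F, hFf, hF⟩ := riesz_extension (Submodule.prod P Q) f
    (by rintro ⟨_, x, rfl⟩ ⟨hxP, hxQ⟩; exact hg x hxP hxQ)
    (by
      rintro ⟨y, z⟩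
      obtain ⟨r, hr, hr0⟩ := ((hunit (y - z)).and (eventually_ge_atTop 0)).exists
      refine ⟨⟨diag (r • x₀ - z), _, rfl⟩, ?_, ?_⟩
      · change r • x₀ - z + y ∈ P
        convert hr using 1
        abel
      · simpa [diag] using Q.smul_mem hr0 hx₀)
  refine ⟨F ∘ₗ LinearMap.inl ℝ V V, F ∘ₗ LinearMap.inr ℝ V V, fun x hx => hF _ ⟨hx, Q.zero_mem⟩,
    fun x hx => hF _ ⟨P.zero_mem, hx⟩, LinearMap.ext fun x => ?_⟩
  have hdiag : F (x, x) = g x := hFf ⟨diag x, x, rfl⟩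
  rw [← hdiag]
  simp [← map_add]

variable {P : PointedCone ℝ V} {x₀ : V} {a : ι → Dual ℝ V} {b : ι → ℝ} {c : Dual ℝ V} {p : ℝ}

theorem le_mul_of_forall_le_mul (hx₀P : x₀ ∈ P) (hx₀ : ∀ i, a i x₀ ≤ b i)
    (hp : ∀ x ∈ P, (∀ i, a i x ≤ b i) → c x ≤ p) {x : V} {t : ℝ} (hx : x ∈ P) (ht : 0 ≤ t)
    (hxt : ∀ i, a i x ≤ t * b i) : c x ≤ t * p := by
  have hpos : ∀ {z : V} {u : ℝ}, z ∈ P → 0 < u → (∀ i, a i z ≤ u * b i) → c z ≤ u * p := by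
    intro z u hz hu hzu
    have := hp (u⁻¹ • z) (P.smul_mem (inv_pos.2 hu).le hz) fun i => by
      simpa [inv_mul_le_iff₀ hu] using hzu i
    simpa [inv_mul_le_iff₀ hu] using this
  -- At `t = 0` there is nothing to rescale by, hence the perturbation towards `x₀`.
  have hperturb : ∀ ε > 0, c x + ε * c x₀ ≤ (t + ε) * p := fun ε hε => by
    simpa using hpos (P.add_mem hx (P.smul_mem hε.le hx₀P)) (add_pos_of_nonneg_of_pos ht hε)
      fun i => by simpa [add_mul] using add_le_add (hxt i) (mul_le_mul_of_nonneg_left (hx₀ i) hε.le)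
  have hlim : ∀ u v : ℝ, Tendsto (fun ε : ℝ => u + ε * v) (𝓝[>] 0) (𝓝 u) := fun u v =>
    tendsto_nhdsWithin_of_tendsto_nhds (Continuous.tendsto' (by fun_prop) _ _ (by simp))
  refine le_of_tendsto_of_tendsto (hlim (c x) (c x₀)) (hlim (t * p) p) ?_
  filter_upwards [self_mem_nhdsWithin] with ε hε
  simpa [add_mul] using hperturb ε hε

theorem exists_nonneg_forall_le_sum_of_slater [Fintype ι]
    (hunit : ∀ y, ∀ᶠ r : ℝ in atTop, y + r • x₀ ∈ P) (hx₀ : ∀ i, a i x₀ ≤ b i)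
    (hp : ∀ x ∈ P, (∀ i, a i x ≤ b i) → c x ≤ p) :
    ∃ y : ι → ℝ, (∀ i, 0 ≤ y i) ∧ (∀ x ∈ P, c x ≤ ∑ i, y i * a i x) ∧ ∑ i, y i * b i ≤ p := by
  have hx₀P : x₀ ∈ P := by
    obtain ⟨r, hr, hr0⟩ := ((hunit 0).and (eventually_gt_atTop 0)).exists
    simpa [hr0.ne'] using P.smul_mem (inv_pos.2 hr0).le hr
  let A : ι → Dual ℝ (V × ℝ) := fun i => (-a i).coprod (b i • LinearMap.id)
  let Q : PointedCone ℝ (V × ℝ) := ⨅ i, (PointedCone.positive ℝ ℝ).comap (A i)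
  have hQ : ∀ z, z ∈ Q ↔ ∀ i, 0 ≤ A i z := fun z => by simp [Q, Submodule.mem_iInf]
  obtain ⟨s, q, hs, hq, hsq⟩ := exists_nonneg_on_add_nonneg_on_eq
    (P := Submodule.prod P (PointedCone.positive ℝ ℝ)) (Q := Q) (x₀ := (x₀, 1))
    ((hQ _).2 fun i => by simpa [A] using hx₀ i)
    (fun z => by
      filter_upwards [hunit z.1, eventually_ge_atTop (-z.2)] with r hr hrz
      exact ⟨hr, by simpa [neg_le_iff_add_nonneg'] using hrz⟩)
    ((-c).coprod (p • LinearMap.id)) (fun z hzP hzQ => by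
      simpa [mul_comm] using le_mul_of_forall_le_mul hx₀P hx₀ hp hzP.1 hzP.2 fun i => by
        simpa [A, mul_comm] using (hQ z).1 hzQ i)
  obtain ⟨y, hy, hyq⟩ := exists_nonneg_sum_smul_eq_of_forall_nonneg A q fun z hz =>
    hq z ((hQ z).2 hz)
  rw [← hyq] at hsq
  refine ⟨y, hy, fun x hx => ?_, ?_⟩
  · have hsx : 0 ≤ s (x, 0) := hs (x, 0) ⟨hx, le_refl (0 : ℝ)⟩
    have hval : s (x, 0) - ∑ i, y i * a i x = -c x := by
      simpa [A, sub_eq_add_neg] using LinearMap.congr_fun hsq (x, 0)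
    linarith
  · have hs1 : 0 ≤ s (0, 1) := hs (0, 1) ⟨P.zero_mem, zero_le_one (α := ℝ)⟩
    have hval : s (0, 1) + ∑ i, y i * b i = p := by
      simpa [A] using LinearMap.congr_fun hsq (0, 1)
    linarith

end ConicDuality

section SemidefiniteDuality

theorem eventually_posSemidef_add_smul {ι : Type*} [Finite ι] {X Y : Matrix ι ι ℝ}
    (hX : X.PosDef) (hY : Y.IsHermitian) : ∀ᶠ r : ℝ in atTop, (Y + r • X).PosSemidef := by
  cases nonempty_fintype ι
  have hXpos : ∀ v ≠ 0, 0 < v ⬝ᵥ X *ᵥ v := fun v hv => by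
    simpa using hX.dotProduct_mulVec_pos hv
  have hcont : ∀ M : Matrix ι ι ℝ, Continuous fun v : ι → ℝ => v ⬝ᵥ M *ᵥ v := fun M => by fun_prop
  obtain ⟨C, hC⟩ := (isCompact_sphere (0 : ι → ℝ) 1).exists_bound_of_continuousOn
    ((hcont Y).continuousOn.div (hcont X).continuousOn fun v hv =>
      (hXpos v (ne_zero_of_mem_unit_sphere ⟨v, hv⟩)).ne')
  filter_upwards [eventually_ge_atTop C] with r hr
  refine .of_dotProduct_mulVec_nonneg (hY.add (hX.isHermitian.smul (.all r))) fun v => ?_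
  rcases eq_or_ne v 0 with rfl | hv
  · simp
  have hratio : |v ⬝ᵥ Y *ᵥ v / v ⬝ᵥ X *ᵥ v| ≤ C := by
    have hmem : ‖v‖⁻¹ • v ∈ Metric.sphere (0 : ι → ℝ) 1 := by simp [norm_smul, hv]
    have hbound := hC _ hmem
    have hnorm : ‖v‖⁻¹ ≠ 0 := inv_ne_zero (norm_ne_zero_iff.2 hv)
    simp only [Pi.div_apply, Matrix.mulVec_smul, dotProduct_smul, smul_dotProduct,
      smul_eq_mul] at hbound
    rwa [mul_div_mul_left _ _ hnorm, mul_div_mul_left _ _ hnorm] at hbound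
  have hYv := (le_div_iff₀ (hXpos v hv)).1 (neg_le_of_abs_le (hratio.trans hr))
  simp only [star_trivial, Matrix.add_mulVec, Matrix.smul_mulVec, dotProduct_add, dotProduct_smul,
    smul_eq_mul]
  linarith

variable {n m : ℕ}

/-- The cone of positive semidefinite matrices in `symHat n`. -/
def psdCone (n : ℕ) : PointedCone ℝ (symHat n) where
  carrier := {X | (X : Matrix (Fin (n + 1)) (Fin (n + 1)) ℝ).PosSemidef}
  add_mem' hX hY := hX.add hY
  zero_mem' := Matrix.PosSemidef.zero
  smul_mem' r _ hX := hX.smul r.2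

theorem isHermitian_coe (X : symHat n) : (X : Matrix (Fin (n + 1)) (Fin (n + 1)) ℝ).IsHermitian :=
  (Matrix.conjTranspose_eq_transpose_of_trivial _).trans X.2

theorem mem_psdCone_iff_forall_inner_nonneg {S : symHat n} :
    S ∈ psdCone n ↔ ∀ X ∈ psdCone n, 0 ≤ inner ℝ S X := by
  refine ⟨fun hS X hX => ?_, fun h => ?_⟩
  · change 0 ≤ ((S : Matrix (Fin (n + 1)) (Fin (n + 1)) ℝ) *
      (X : Matrix (Fin (n + 1)) (Fin (n + 1)) ℝ)ᵀ).trace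
    rw [← Matrix.sum_hadamard_eq]
    simpa [dotProduct, Matrix.mulVec] using
      (Matrix.PosSemidef.hadamard hS hX).dotProduct_mulVec_nonneg 1
  · refine .of_dotProduct_mulVec_nonneg (isHermitian_coe S) fun v => ?_
    have hv : (Matrix.vecMulVec v v).PosSemidef := by
      simpa using Matrix.posSemidef_vecMulVec_self_star v
    have hinner :
        0 ≤ ((S : Matrix (Fin (n + 1)) (Fin (n + 1)) ℝ) * (Matrix.vecMulVec v v)ᵀ).trace :=
      h ⟨Matrix.vecMulVec v v, Matrix.transpose_vecMulVec v v⟩ hv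
    rwa [Matrix.transpose_vecMulVec, Matrix.mul_vecMulVec, Matrix.trace_vecMulVec,
      dotProduct_comm, ← star_trivial v] at hinner

variable {𝒜 : symHat n →ₗ[ℝ] EuclideanSpace ℝ (Fin m)} {b y : EuclideanSpace ℝ (Fin m)}
  {C X : symHat n}

theorem convex_feasibleSet (𝒜 : symHat n →ₗ[ℝ] EuclideanSpace ℝ (Fin m))
    (b : EuclideanSpace ℝ (Fin m)) : Convex ℝ (feasibleSet 𝒜 b) := by
  have hle : Convex ℝ {X | ∀ i, 𝒜 X i ≤ b i} := by
    simp only [Set.ofPred_forall]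
    exact convex_iInter fun i =>
      convex_halfSpace_le ((EuclideanSpace.projₗ i).comp 𝒜).isLinear (b i)
  exact (psdCone n).convex.inter hle

theorem inner_le_inner_of_isDualFeasible (hX : X ∈ feasibleSet 𝒜 b) (hy : IsDualFeasible 𝒜 C y) :
    inner ℝ C X ≤ inner ℝ b y := by
  have hslack := mem_psdCone_iff_forall_inner_nonneg.1 hy.2 X hX.1
  rw [dualSlack, inner_sub_left, LinearMap.adjoint_inner_left, sub_nonneg] at hslack
  calc inner ℝ C X ≤ inner ℝ y (𝒜 X) := hslack
    _ ≤ inner ℝ y b := by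
      simp only [PiLp.inner_apply]
      exact Finset.sum_le_sum fun i _ => by
        simpa [mul_comm] using mul_le_mul_of_nonneg_left (hX.2 i) (hy.1 i)
    _ = inner ℝ b y := real_inner_comm _ _

theorem exists_isDualFeasible_inner_le {p : ℝ}
    (hpos : ∃ X ∈ feasibleSet 𝒜 b, (X : Matrix (Fin (n + 1)) (Fin (n + 1)) ℝ).PosDef)
    (hp : ∀ X ∈ feasibleSet 𝒜 b, inner ℝ C X ≤ p) :
    ∃ y, IsDualFeasible 𝒜 C y ∧ inner ℝ b y ≤ p := by
  obtain ⟨X₀, hX₀, hX₀pos⟩ := hpos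
  obtain ⟨y, hy, hCy, hby⟩ := exists_nonneg_forall_le_sum_of_slater (P := psdCone n)
    (a := fun i => EuclideanSpace.projₗ i ∘ₗ 𝒜) (b := b) (c := innerₗ (symHat n) C)
    (fun Y => eventually_posSemidef_add_smul hX₀pos (isHermitian_coe Y)) hX₀.2
    (fun X hX hXb => hp X ⟨hX, hXb⟩)
  refine ⟨WithLp.toLp 2 y, ⟨hy, mem_psdCone_iff_forall_inner_nonneg.2 fun X hX => ?_⟩, ?_⟩
  · rw [dualSlack, inner_sub_left, LinearMap.adjoint_inner_left, sub_nonneg]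
    simpa [PiLp.inner_apply, mul_comm] using hCy X hX
  · simpa [PiLp.inner_apply] using hby

theorem exists_isDualOptimal_inner_eq
    (hpos : ∃ X ∈ feasibleSet 𝒜 b, (X : Matrix (Fin (n + 1)) (Fin (n + 1)) ℝ).PosDef)
    (hX : X ∈ feasibleSet 𝒜 b) (hmax : ∀ Z ∈ feasibleSet 𝒜 b, inner ℝ C Z ≤ inner ℝ C X) :
    ∃ y, IsDualOptimal 𝒜 b C y ∧ inner ℝ b y = inner ℝ C X := by
  obtain ⟨y, hy, hyX⟩ := exists_isDualFeasible_inner_le hpos hmax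
  exact ⟨y, ⟨hy, fun z hz => hyX.trans (inner_le_inner_of_isDualFeasible hX hz)⟩,
    hyX.antisymm (inner_le_inner_of_isDualFeasible hX hy)⟩

end SemidefiniteDuality

section IntegralPoints

theorem tendsto_natCast_mul_add_sub_of_isMaxOn {X : Type*} [TopologicalSpace X] {K : Set X}
    {f g : X → ℝ} {x : X} {w : ℕ → X} (hK : IsCompact K) (hf : Continuous f) (hg : Continuous g)
    (hx : x ∈ K) (hfx : IsMaxOn f K x) (hgx : IsMaxOn g {y ∈ K | f y = f x} x)
    (hwK : ∀ N, w N ∈ K) (hw : ∀ N : ℕ, IsMaxOn (fun y => N * f y + g y) K (w N)) :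
    Tendsto (fun N : ℕ => N * f (w N) + g (w N) - N * f x) atTop (𝓝 (g x)) := by
  have hle : ∀ N : ℕ, N * f x + g x ≤ N * f (w N) + g (w N) := fun N => hw N hx
  refine tendsto_order.2 ⟨fun u hu => .of_forall fun N => by linarith [hle N], fun u hu => ?_⟩
  suffices hgw : ∀ᶠ N in atTop, g (w N) < u by
    filter_upwards [hgw] with N hN
    have hfw : N * f (w N) ≤ N * f x := mul_le_mul_of_nonneg_left (hfx (hwK N)) N.cast_nonneg
    linarith
  rcases (K ∩ {z | u ≤ g z}).eq_empty_or_nonempty with hempty | hne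
  · exact .of_forall fun N => not_le.1 fun h => Set.eq_empty_iff_forall_notMem.1 hempty _ ⟨hwK N, h⟩
  obtain ⟨z, ⟨hzK, huz⟩, hz⟩ := (hK.inter_right (isClosed_le continuous_const hg)).exists_isMaxOn
    hne hf.continuousOn
  obtain ⟨v, -, hv⟩ := hK.exists_isMaxOn ⟨x, hx⟩ hg.continuousOn
  have hfz : f z < f x := (hfx hzK).lt_of_ne fun h => (hu.trans_le huz).not_ge (hgx ⟨hzK, h⟩)
  have hgap : ∀ᶠ N : ℕ in atTop, g v - g x < N * (f x - f z) :=
    (tendsto_natCast_atTop_atTop.atTop_mul_const (sub_pos.2 hfz)).eventually_gt_atTop _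
  filter_upwards [hgap] with N hN
  by_contra! hNu
  have hfw : N * f (w N) ≤ N * f z :=
    mul_le_mul_of_nonneg_left (hz ⟨hwK N, hNu⟩) N.cast_nonneg
  have hgv : g (w N) ≤ g v := hv (hwK N)
  linarith [hle N]

theorem toExposed_nonempty {E : Type*} [AddCommGroup E] [Module ℝ E] [TopologicalSpace E]
    {K : Set E} (hK : IsCompact K) (hne : K.Nonempty) (l : E →L[ℝ] ℝ) : (l.toExposed K).Nonempty :=
  hK.exists_isMaxOn hne l.continuous.continuousOn

variable {d : ℕ} {C : Set (EuclideanSpace ℝ (Fin d))} {c e : EuclideanSpace ℝ (Fin d)}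

/-- Integrality of the support function of `C`, wherever it is attained: the maximum of `⟨c, ·⟩`
over `C` is an integer for each integer vector `c`. -/
def HasIntegralSupport (C : Set (EuclideanSpace ℝ (Fin d))) : Prop :=
  ∀ c, IsIntegralVec c → ∀ x ∈ (innerSL ℝ c).toExposed C, ∃ z : ℤ, inner ℝ c x = z

theorem isIntegralVec_natCast_smul_add (hc : IsIntegralVec c) (he : IsIntegralVec e) (N : ℕ) :
    IsIntegralVec ((N : ℝ) • c + e) := fun i => by
  obtain ⟨p, hp⟩ := hc i
  obtain ⟨q, hq⟩ := he i
  exact ⟨N * p + q, by simp [hp, hq]⟩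

theorem HasIntegralSupport.toExposed (h : HasIntegralSupport C) (hC : IsCompact C)
    (hc : IsIntegralVec c) : HasIntegralSupport ((innerSL ℝ c).toExposed C) := by
  rintro e he x ⟨⟨hxC, hxc⟩, hxe⟩
  choose w hwC hw using fun N : ℕ => toExposed_nonempty hC ⟨x, hxC⟩ (innerSL ℝ ((N : ℝ) • c + e))
  have hlim : Tendsto (fun N : ℕ => N * inner ℝ c (w N) + inner ℝ e (w N) - N * inner ℝ c x)
      atTop (𝓝 (inner ℝ e x)) :=
    tendsto_natCast_mul_add_sub_of_isMaxOn hC (innerSL ℝ c).continuous (innerSL ℝ e).continuous hxC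
      hxc (fun y hy => hxe y ⟨hy.1, fun z hz => (hxc z hz).trans_eq hy.2.symm⟩) hwC
      (fun N y hy => by simpa [inner_add_left, real_inner_smul_left] using hw N y hy)
  obtain ⟨p, hp⟩ := h c hc x ⟨hxC, hxc⟩
  have hint : ∀ N : ℕ, N * inner ℝ c (w N) + inner ℝ e (w N) - N * inner ℝ c x ∈
      Set.range ((↑) : ℤ → ℝ) := fun N => by
    obtain ⟨q, hq⟩ := h _ (isIntegralVec_natCast_smul_add hc he N) (w N) ⟨hwC N, hw N⟩
    rw [inner_add_left, real_inner_smul_left] at hq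
    exact ⟨q - N * p, by push_cast; rw [hq, hp]⟩
  obtain ⟨z, hz⟩ := Int.isClosedEmbedding_coe_real.isClosed_range.mem_of_tendsto hlim
    (.of_forall hint)
  exact ⟨z, hz.symm⟩

theorem isIntegralVec_single_one (i : Fin d) : IsIntegralVec (EuclideanSpace.single i (1 : ℝ)) :=
  fun j => ⟨if j = i then 1 else 0, by simp⟩

theorem HasIntegralSupport.exists_isIntegralVec (h : HasIntegralSupport C) (hC : IsCompact C)
    (hne : C.Nonempty) : ∃ x ∈ C, IsIntegralVec x := by
  suffices hs : ∀ s : Finset (Fin d), ∃ x ∈ C, ∀ i ∈ s, ∃ z : ℤ, x i = z by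
    simpa [IsIntegralVec] using hs Finset.univ
  intro s
  induction s using Finset.induction_on generalizing C with
  | empty => exact hne.imp fun x hx => ⟨hx, by simp⟩
  | insert i s _ ih =>
    have hi := isIntegralVec_single_one i
    obtain ⟨x, hx, hxs⟩ := ih (h.toExposed hC hi)
      (ContinuousLinearMap.toExposed.isExposed.isCompact hC) (toExposed_nonempty hC hne _)
    exact ⟨x, hx.1, Finset.forall_mem_insert _ _ _ |>.2
      ⟨by simpa [EuclideanSpace.inner_single_left] using h _ hi x hx, hxs⟩⟩

theorem isIntegralVec_iff_mem_span : IsIntegralVec c ↔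
    c ∈ Submodule.span ℤ (Set.range (EuclideanSpace.basisFun (Fin d) ℝ).toBasis) := by
  simp only [Basis.mem_span_iff_repr_mem]
  simp [IsIntegralVec, eq_comm]

theorem finite_setOf_isIntegralVec (hC : Bornology.IsBounded C) :
    {x | x ∈ C ∧ IsIntegralVec x}.Finite := by
  simp only [isIntegralVec_iff_mem_span]
  exact ZSpan.setFinite_inter _ hC

theorem exists_isIntegralVec_mem_of_isOpen {U : Set (EuclideanSpace ℝ (Fin d))} (hU : IsOpen U)
    (hne : U.Nonempty) (hsmul : ∀ r : ℝ, 0 < r → ∀ u ∈ U, r • u ∈ U) :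
    ∃ u ∈ U, IsIntegralVec u := by
  obtain ⟨u, hu⟩ := hne
  let B := (EuclideanSpace.basisFun (Fin d) ℝ).toBasis
  have hfract : Tendsto (fun N : ℕ => (N : ℝ)⁻¹ • ZSpan.fract B ((N : ℝ) • u)) atTop (𝓝 0) :=
    tendsto_inv_atTop_nhds_zero_nat.zero_smul_isBoundedUnder_le
      (isBoundedUnder_of ⟨_, fun N => ZSpan.norm_fract_le B _⟩)
  have hlim : Tendsto (fun N : ℕ => u - (N : ℝ)⁻¹ • ZSpan.fract B ((N : ℝ) • u)) atTop (𝓝 u) := by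
    simpa using tendsto_const_nhds.sub hfract
  obtain ⟨N, hNU, hN⟩ := ((hlim.eventually_mem (hU.mem_nhds hu)).and (eventually_gt_atTop 0)).exists
  have hNpos : (0 : ℝ) < N := Nat.cast_pos.2 hN
  refine ⟨ZSpan.floor B ((N : ℝ) • u), ?_, isIntegralVec_iff_mem_span.2 (SetLike.coe_mem _)⟩
  simpa [ZSpan.fract_apply, smul_sub, hNpos.ne'] using hsmul N hNpos _ hNU

theorem HasIntegralSupport.subset_integerHull (h : HasIntegralSupport C) (hC : IsCompact C) :
    C ⊆ integerHull C := by
  intro x hx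
  by_contra hxI
  let Z := {z | z ∈ C ∧ IsIntegralVec z}
  have hZ : Z.Finite := finite_setOf_isIntegralVec hC.isBounded
  obtain ⟨l, hl⟩ : ∃ u : EuclideanSpace ℝ (Fin d), ∀ z ∈ Z, inner ℝ u z < inner ℝ u x := by
    obtain ⟨f, r, hfx, hf⟩ := geometric_hahn_banach_point_closed (convex_convexHull ℝ Z)
      (hZ.isClosed_convexHull ℝ) hxI
    refine ⟨-(InnerProductSpace.toDual ℝ _).symm f, fun z hz => ?_⟩
    simpa using hfx.trans (hf z (subset_convexHull ℝ Z hz))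
  obtain ⟨c, hcZ, hc⟩ := exists_isIntegralVec_mem_of_isOpen
    (U := ⋂ z ∈ Z, {u | inner ℝ u z < inner ℝ u x})
    (hZ.isOpen_biInter fun z _ => isOpen_lt (by fun_prop) (by fun_prop)) ⟨l, by simpa using hl⟩
    (fun r hr u hu => by simpa [real_inner_smul_left, hr] using hu)
  obtain ⟨z, hz, hzint⟩ := (h.toExposed hC hc).exists_isIntegralVec
    (ContinuousLinearMap.toExposed.isExposed.isCompact hC) (toExposed_nonempty hC ⟨x, hx⟩ _)
  exact (Set.mem_iInter₂.1 hcZ z ⟨hz.1, hzint⟩).not_ge (hz.2 x hx)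

end IntegralPoints

section TotalDualIntegrality

variable {n m k : ℕ} {𝒜 : symHat n →ₗ[ℝ] EuclideanSpace ℝ (Fin m)} {b : EuclideanSpace ℝ (Fin m)}
  {ℒ : EuclideanSpace ℝ (Fin k) →ₗ[ℝ] symHat n}

theorem exists_int_inner_eq_of_isIntegralVec {d : ℕ} {x y : EuclideanSpace ℝ (Fin d)}
    (hx : IsIntegralVec x) (hy : IsIntegralVec y) : ∃ z : ℤ, inner ℝ x y = z := by
  choose p hp using hx
  choose q hq using hy
  exact ⟨∑ i, p i * q i, by simp [PiLp.inner_apply, hp, hq, mul_comm]⟩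

theorem IsTDIThrough.exists_int_inner_eq (hTDI : IsTDIThrough 𝒜 b ℒ) (hb : IsIntegralVec b)
    {c : EuclideanSpace ℝ (Fin k)} (hc : IsIntegralVec c) {y : EuclideanSpace ℝ (Fin m)}
    (hy : IsDualOptimal 𝒜 b (ℒ c) y) : ∃ z : ℤ, inner ℝ b y = z := by
  obtain ⟨z, hz, hint, -⟩ := hTDI c hc ⟨y, hy⟩
  rw [(hy.2 z hz.1).antisymm (hz.2 y hy.1)]
  exact exists_int_inner_eq_of_isIntegralVec hb hint

theorem hasIntegralSupport_image_feasibleSet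
    (hpos : ∃ X ∈ feasibleSet 𝒜 b, (X : Matrix (Fin (n + 1)) (Fin (n + 1)) ℝ).PosDef)
    (hval : ∀ c, IsIntegralVec c → ∀ y, IsDualOptimal 𝒜 b (ℒ c) y → ∃ z : ℤ, inner ℝ b y = z) :
    HasIntegralSupport (LinearMap.adjoint ℒ '' feasibleSet 𝒜 b) := by
  rintro c hc _ ⟨⟨X, hX, rfl⟩, hmax⟩
  obtain ⟨y, hy, hyX⟩ := exists_isDualOptimal_inner_eq (C := ℒ c) hpos hX fun Z hZ => by
    simpa [LinearMap.adjoint_inner_right] using hmax _ (Set.mem_image_of_mem _ hZ)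
  rw [LinearMap.adjoint_inner_right, ← hyX]
  exact hval c hc y hy

end TotalDualIntegrality

end SemidefTDI

theorem theorem13_general {n m k : ℕ}
    (𝒜 : SemidefTDI.symHat n →ₗ[ℝ] EuclideanSpace ℝ (Fin m))
    (b : EuclideanSpace ℝ (Fin m))
    (ℒ : EuclideanSpace ℝ (Fin k) →ₗ[ℝ] SemidefTDI.symHat n)
    (hval : ∀ c, SemidefTDI.IsIntegralVec c → ∀ y, SemidefTDI.IsDualOptimal 𝒜 b (ℒ c) y →
      ∃ z : ℤ, inner ℝ b y = z)
    (hcompact : IsCompact (LinearMap.adjoint ℒ '' SemidefTDI.feasibleSet 𝒜 b))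
    (hpos : ∃ X ∈ SemidefTDI.feasibleSet 𝒜 b,
      (X : Matrix (Fin (n + 1)) (Fin (n + 1)) ℝ).PosDef) :
    LinearMap.adjoint ℒ '' SemidefTDI.feasibleSet 𝒜 b =
      SemidefTDI.integerHull (LinearMap.adjoint ℒ '' SemidefTDI.feasibleSet 𝒜 b) :=
  have hsupport := SemidefTDI.hasIntegralSupport_image_feasibleSet hpos hval
  have hconvex := (SemidefTDI.convex_feasibleSet 𝒜 b).linear_image (LinearMap.adjoint ℒ)
  (hsupport.subset_integerHull hcompact).antisymm (convexHull_min (fun _ hx => hx.1) hconvex)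

theorem theorem13 {n m k : ℕ}
    (𝒜 : SemidefTDI.symHat n →ₗ[ℝ] EuclideanSpace ℝ (Fin m))
    (b : EuclideanSpace ℝ (Fin m))
    (ℒ : EuclideanSpace ℝ (Fin k) →ₗ[ℝ] SemidefTDI.symHat n)
    (hTDI : SemidefTDI.IsTDIThrough 𝒜 b ℒ)
    (hb : SemidefTDI.IsIntegralVec b)
    (hcompact : IsCompact (LinearMap.adjoint ℒ '' SemidefTDI.feasibleSet 𝒜 b))
    (hpos : ∃ X ∈ SemidefTDI.feasibleSet 𝒜 b,
      (X : Matrix (Fin (n + 1)) (Fin (n + 1)) ℝ).PosDef) :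
    LinearMap.adjoint ℒ '' SemidefTDI.feasibleSet 𝒜 b =
      SemidefTDI.integerHull (LinearMap.adjoint ℒ '' SemidefTDI.feasibleSet 𝒜 b) :=
  theorem13_general 𝒜 b ℒ (fun _ hc _ hy => hTDI.exists_int_inner_eq hb hc hy) hcompact hpos
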